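/- Let $k\ge 1$ and ${\bf n}=(n_1,\dots,n_k)$ with each $n_i\ge 1$ an integer. Let $F^2(H_{n_i})$ be the full Fock space over an $n_i$-dimensional complex Hilbert space $H_{n_i}$, with its orthonormal basis $\{e^i_\alpha\}$ indexed by the words $\alpha$ of the unital free semigroup $\mathbb F_{n_i}^+$ with generators $g^i_1,\dots,g^i_{n_i}$. Let $S_{i,j}e^i_\alpha=e^i_{g^i_j\alpha}$ and $R_{i,j}e^i_\alpha=e^i_{\alpha g^i_j}$ be the left and right creation operators on $F^2(H_{n_i})$, and let ${\bf S}_{i,j}$ and ${\bf R}_{i,j}$ be the operators on the Hilbert tensor product $\bigotimes_{i=1}^kF^2(H_{n_i})$ that act as $S_{i,j}$, respectively $R_{i,j}$, on the $i$-th factor and as the identity on the other factors. The polyball algebra $\mathcal A_{\bf n}$ is the norm-closed (non-selfadjoint) algebra generated by all ${\bf S}_{i,j}$ and the identity. For a complex Hilbert space $\mathcal E$, $B(\mathcal E)\otimes_{min}\mathcal A_{\bf n}$ denotes the norm closure in $B(\mathcal E\otimes\bigotimes_{i=1}^kF^2(H_{n_i}))$ of the linear span of the operators $a\otimes T$ with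 $a\in B(\mathcal E)$, $T\in\mathcal A_{\bf n}$. A bounded operator $A$ on $\mathcal E\otimes\bigotimes_{i=1}^kF^2(H_{n_i})$ is called $k$-multi-Toeplitz if $$(I_{\mathcal E}\otimes{\bf R}_{i,s}^*)\,A\,(I_{\mathcal E}\otimes{\bf R}_{i,t})=\delta_{st}A\qquad\text{for all } i\in\{1,\dots,k\},\ s,t\in\{1,\dots,n_i\};$$ a bounded operator $T$ on $\bigotimes_{i=1}^kF^2(H_{n_i})$ is called $k$-multi-Toeplitz if ${\bf R}_{i,s}^*T{\bf R}_{i,t}=\delta_{st}T$ for all such $i,s,t$. Then, for every complex Hilbert space $\mathcal E$, the set of all $k$-multi-Toeplitz operators on $\mathcal E\otimes\bigotimes_{i=1}^kF^2(H_{n_i})$ is equal to the closure in the strong operator topology, and also to the closure in the weak operator topology, of the linear span $$\mathrm{span}\{f^*g:\ f,g\in B(\mathcal E)\otimes_{min}\mathcal A_{\bf n}\}.$$ Moreover, the set of all $k$-multi-Toeplitz operators on $\bigotimes_{i=1}^kF^2(H_{n_i})$ is equal to the closure in the strong operator topology, and also to the closure in the weak operator topology, of $\mathrm{span}\{f^*g:\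 f,g\in\mathcal A_{\bf n}\}$. -/

import Mathlib

open scoped TensorProduct

noncomputable section

/-! ### Hilbert tensor products of two Hilbert spaces -/

/-- The Hilbert tensor product `E ⊗ F`: the completion of the algebraic tensor product with respect
to the inner product `⟪x ⊗ y, x' ⊗ y'⟫ = ⟪x, x'⟫ * ⟪y, y'⟫`. -/
abbrev HilbertTensor (E F : Type*) [NormedAddCommGroup E] [InnerProductSpace ℂ E]
    [NormedAddCommGroup F] [InnerProductSpace ℂ F] : Type _ :=
  UniformSpace.Completion (E ⊗[ℂ] F)

/-- The operator `a ⊗ T` on `E ⊗ F`: the continuous extension of `x ⊗ y ↦ a x ⊗ T y`. -/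
def opTensor {E F : Type*} [NormedAddCommGroup E] [InnerProductSpace ℂ E]
    [NormedAddCommGroup F] [InnerProductSpace ℂ F] (a : E →L[ℂ] E) (T : F →L[ℂ] F) :
    HilbertTensor E F →L[ℂ] HilbertTensor E F :=
  (TensorProduct.mapL a T).completion

theorem opTensor_tmul {E F : Type*} [NormedAddCommGroup E] [InnerProductSpace ℂ E]
    [NormedAddCommGroup F] [InnerProductSpace ℂ F] (a : E →L[ℂ] E) (T : F →L[ℂ] F)
    (x : E) (y : F) :
    opTensor a T ((x ⊗ₜ[ℂ] y : E ⊗[ℂ] F) : HilbertTensor E F)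
      = ((a x ⊗ₜ[ℂ] T y : E ⊗[ℂ] F) : HilbertTensor E F) := by
  simp [opTensor]

/-- The spatial (minimal) tensor product `B(E) ⊗_min 𝒜` of `B(E)` with an algebra `𝒜` of operators
on `F`: the operator-norm closure in `B(E ⊗ F)` of the linear span of the `a ⊗ T`, `T ∈ 𝒜`. -/
def minTensor (E : Type*) {F : Type*} [NormedAddCommGroup E] [InnerProductSpace ℂ E]
    [NormedAddCommGroup F] [InnerProductSpace ℂ F] (𝒜 : Subalgebra ℂ (F →L[ℂ] F)) :
    Submodule ℂ (HilbertTensor E F →L[ℂ] HilbertTensor E F) :=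
  (Submodule.span ℂ {X | ∃ a : E →L[ℂ] E, ∃ T ∈ 𝒜, X = opTensor a T}).topologicalClosure

/-! ### Closures in the strong and the weak operator topology -/

/-- Closure of a set of bounded operators in the strong operator topology
(the topology of pointwise convergence in norm). -/
def sotClosure {K : Type*} [NormedAddCommGroup K] [InnerProductSpace ℂ K]
    (M : Set (K →L[ℂ] K)) : Set (K →L[ℂ] K) :=
  {T | ContinuousLinearMap.toPointwiseConvergenceCLM ℂ (RingHom.id ℂ) K K T ∈
    closure (ContinuousLinearMap.toPointwiseConvergenceCLM ℂ (RingHom.id ℂ) K K '' M)}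

/-- Closure of a set of bounded operators in the weak operator topology. -/
def wotClosure {K : Type*} [NormedAddCommGroup K] [InnerProductSpace ℂ K]
    (M : Set (K →L[ℂ] K)) : Set (K →L[ℂ] K) :=
  {T | (ContinuousLinearMapWOT.ofCLM T : K →WOT[ℂ] K) ∈
    closure ((ContinuousLinearMapWOT.ofCLM : (K →L[ℂ] K) → (K →WOT[ℂ] K)) '' M)}

/-! ### Full Fock spaces and creation operators -/

theorem memlp_extend {I : Type*} {φ : I → I} (hφ : Function.Injective φ)
    (f : lp (fun _ : I => ℂ) 2) : Memℓp (E := fun _ : I => ℂ) (Function.extend φ f 0) 2 := by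
  have h2 : (0 : ℝ) < (2 : ENNReal).toReal := by norm_num
  refine (memℓp_gen_iff h2).2 ((hφ.summable_iff ?_).1 ?_)
  · intro x hx
    rw [Function.extend_apply' _ _ _ (by simpa using hx)]
    simp
  · simpa [Function.comp_def, hφ.extend_apply] using (memℓp_gen_iff h2).1 (lp.memℓp f)

/-- The isometry of `ℓ²(I)` with `e_ω ↦ e_{φ ω}`, for an injective map `φ : I → I`: the value of
the image of `f` at `φ ω` is `f ω`, and its values outside the range of `φ` are `0`. -/
def basisIsometry {I : Type*} (φ : I → I) (hφ : Function.Injective φ) :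
    lp (fun _ : I => ℂ) 2 →ₗᵢ[ℂ] lp (fun _ : I => ℂ) 2 where
  toFun f := ⟨Function.extend φ f 0, memlp_extend hφ f⟩
  map_add' f g := by
    ext x
    by_cases hx : ∃ y, φ y = x
    · obtain ⟨y, rfl⟩ := hx
      change Function.extend φ (⇑f + ⇑g) 0 (φ y)
        = Function.extend φ (⇑f) 0 (φ y) + Function.extend φ (⇑g) 0 (φ y)
      simp only [hφ.extend_apply, Pi.add_apply]
    · change Function.extend φ (⇑f + ⇑g) 0 x
        = Function.extend φ (⇑f) 0 x + Function.extend φ (⇑g) 0 x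
      simp [Function.extend_apply' _ _ _ hx]
  map_smul' c f := by
    ext x
    by_cases hx : ∃ y, φ y = x
    · obtain ⟨y, rfl⟩ := hx
      simp [hφ.extend_apply]
    · simp [Function.extend_apply' _ _ _ hx]
  norm_map' f := by
    have h2 : (0 : ℝ) < (2 : ENNReal).toReal := by norm_num
    simp only [LinearMap.coe_mk, AddHom.coe_mk]
    rw [lp.norm_eq_tsum_rpow h2, lp.norm_eq_tsum_rpow h2, ← hφ.tsum_eq]
    · simp [hφ.extend_apply]
    · intro x hx
      by_contra h
      refine hx ?_
      simp [Function.extend_apply' _ _ _ (show ¬ ∃ y, φ y = x by simpa using h)]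

theorem basisIsometry_single {I : Type*} [DecidableEq I] (φ : I → I) (hφ : Function.Injective φ)
    (ω : I) : basisIsometry φ hφ (lp.single 2 ω 1) = lp.single 2 (φ ω) 1 := by
  ext x
  change Function.extend φ (Pi.single ω 1 : I → ℂ) 0 x = (Pi.single (φ ω) 1 : I → ℂ) x
  by_cases hx : ∃ y, φ y = x
  · obtain ⟨y, rfl⟩ := hx
    simp [hφ.extend_apply, Pi.single_apply, hφ.eq_iff]
  · rw [Function.extend_apply' _ _ _ hx, Pi.single_eq_of_ne (fun h => hx ⟨ω, h.symm⟩)]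
    rfl

/-- The full Fock space `F²(H_m) = ℂ ⊕ ⨁_{p ≥ 1} H_m^{⊗p}` on `m` generators, `H_m` of dimension
`m`, as `ℓ²(𝔽_m⁺)`: its orthonormal basis `e_α` is indexed by the free monoid `𝔽_m⁺`, where `e_α`
stands for `e_{j₁} ⊗ ⋯ ⊗ e_{j_p}` if `α = g_{j₁} ⋯ g_{j_p}`, and for `1 ∈ ℂ` if `α` is empty. -/
abbrev Fock (m : ℕ) : Type := lp (fun _ : FreeMonoid (Fin m) => ℂ) 2

/-- The index set `𝔽⁺_{n₁} × ⋯ × 𝔽⁺_{n_k}`. -/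
abbrev MultiWord {k : ℕ} (n : Fin k → ℕ) : Type := ∀ i, FreeMonoid (Fin (n i))

/-- The Hilbert tensor product `F²(H_{n₁}) ⊗ ⋯ ⊗ F²(H_{n_k})`, as the `ℓ²`-space whose orthonormal
basis vector at `(γ₁, …, γ_k)` is `e_{γ₁} ⊗ ⋯ ⊗ e_{γ_k}`; elementary tensors are `pureTensor`. -/
abbrev PolyFock {k : ℕ} (n : Fin k → ℕ) : Type := lp (fun _ : MultiWord n => ℂ) 2

/-- Products of absolutely summable families. -/
theorem hasSum_pi_prod {k : ℕ} {I : Fin k → Type} (f : ∀ i, I i → ℂ) (s : Fin k → ℂ)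
    (hf : ∀ i, HasSum (f i) (s i)) :
    HasSum (fun ω : ∀ i, I i => ∏ i, f i (ω i)) (∏ i, s i) := by
  induction k with
  | zero => simp
  | succ k ih =>
    have h := ih (fun i => f i.succ) (fun i => s i.succ) (fun i => hf i.succ)
    have h0 : Summable fun x => ‖f 0 x‖ := (hf 0).summable.norm
    have h1 : Summable fun ω : ∀ i : Fin k, I i.succ => ‖∏ i, f (Fin.succ i) (ω i)‖ :=
      h.summable.norm
    have h' := (hf 0).mul h (summable_mul_of_summable_norm (f := f 0)
      (g := fun ω : ∀ i : Fin k, I i.succ => ∏ i, f (Fin.succ i) (ω i)) h0 h1)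
    rw [Fin.prod_univ_succ]
    refine (Equiv.hasSum_iff (Fin.consEquiv I) (f := fun ω : ∀ i, I i => ∏ i, f i (ω i))).1 ?_
    have h2 : ((fun ω : ∀ i, I i => ∏ i, f i (ω i)) ∘ Fin.consEquiv I)
        = fun x => f 0 x.1 * ∏ i, f (Fin.succ i) (x.2 i) := by
      funext x
      simp [Fin.consEquiv, Fin.prod_univ_succ]
    rw [h2]
    exact h'

theorem memlp_prod {k : ℕ} {n : Fin k → ℕ} (f : ∀ i, Fock (n i)) :
    Memℓp (E := fun _ : MultiWord n => ℂ) (fun ω => ∏ i, f i (ω i)) 2 := by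
  have h2 : (0 : ℝ) < (2 : ENNReal).toReal := by norm_num
  have h : ∀ i, Summable fun ω => ((‖f i ω‖ ^ 2 : ℝ) : ℂ) := fun i => by
    have := (memℓp_gen_iff h2).1 (lp.memℓp (f i))
    exact Complex.hasSum_ofReal.2 (by simpa using this.hasSum) |>.summable
  have := (hasSum_pi_prod _ _ fun i => (h i).hasSum).summable
  refine (memℓp_gen_iff h2).2 ?_
  rw [← Complex.summable_ofReal]
  simpa [Finset.prod_pow] using this

/-- The elementary tensor `f₁ ⊗ ⋯ ⊗ f_k`. -/
def pureTensor {k : ℕ} {n : Fin k → ℕ} (f : ∀ i, Fock (n i)) : PolyFock n :=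
  ⟨fun ω => ∏ i, f i (ω i), memlp_prod f⟩

theorem inner_pureTensor {k : ℕ} {n : Fin k → ℕ} (f g : ∀ i, Fock (n i)) :
    inner ℂ (pureTensor f) (pureTensor g) = ∏ i, inner ℂ (f i) (g i) := by
  have h := hasSum_pi_prod _ _ fun i => lp.hasSum_inner (𝕜 := ℂ) (f i) (g i)
  rw [lp.inner_eq_tsum, ← h.tsum_eq]
  refine tsum_congr fun ω => ?_
  simp [pureTensor, Finset.prod_mul_distrib]

open Classical in
theorem pureTensor_single {k : ℕ} {n : Fin k → ℕ} (γ : MultiWord n) :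
    pureTensor (fun i => (lp.single 2 (γ i) 1 : Fock (n i))) = lp.single 2 γ 1 := by
  ext ω
  change ∏ i, (Pi.single (γ i) (1 : ℂ) : FreeMonoid (Fin (n i)) → ℂ) (ω i)
    = (Pi.single γ 1 : MultiWord n → ℂ) ω
  by_cases h : ω = γ
  · subst h; simp
  · obtain ⟨i, hi⟩ := Function.ne_iff.1 h
    rw [Pi.single_eq_of_ne h, Finset.prod_eq_zero (Finset.mem_univ i)]
    exact Pi.single_eq_of_ne hi _

theorem leftMul_injective {m : ℕ} (j : Fin m) :
    Function.Injective fun α : FreeMonoid (Fin m) => FreeMonoid.of j * α :=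
  mul_right_injective _

theorem rightMul_injective {m : ℕ} (j : Fin m) :
    Function.Injective fun α : FreeMonoid (Fin m) => α * FreeMonoid.of j :=
  mul_left_injective _

/-- The left creation operator `S_j e_α = e_{g_j α}` on the full Fock space. -/
def leftCreation {m : ℕ} (j : Fin m) : Fock m →L[ℂ] Fock m :=
  (basisIsometry _ (leftMul_injective j)).toContinuousLinearMap

/-- The right creation operator `R_j e_α = e_{α g_j}` on the full Fock space. -/
def rightCreation {m : ℕ} (j : Fin m) : Fock m →L[ℂ] Fock m :=
  (basisIsometry _ (rightMul_injective j)).toContinuousLinearMap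

theorem coordMap_injective {k : ℕ} {n : Fin k → ℕ} (i : Fin k)
    {φ : FreeMonoid (Fin (n i)) → FreeMonoid (Fin (n i))} (hφ : Function.Injective φ) :
    Function.Injective fun γ : MultiWord n => Function.update γ i (φ (γ i)) := by
  intro γ δ h
  funext l
  by_cases hl : l = i
  · subst hl
    exact hφ (by simpa using congrFun h l)
  · simpa [hl] using congrFun h l

/-- `I ⊗ ⋯ ⊗ I ⊗ V_φ ⊗ I ⊗ ⋯ ⊗ I`, where `V_φ e_α = e_{φ α}` acts on the `i`-th factor: the
operator that sends `e_{γ₁} ⊗ ⋯ ⊗ e_{γ_k}` to the basis vector with `γ_i` replaced by `φ γ_i`. -/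
def ampliation {k : ℕ} {n : Fin k → ℕ} (i : Fin k)
    {φ : FreeMonoid (Fin (n i)) → FreeMonoid (Fin (n i))} (hφ : Function.Injective φ) :
    PolyFock n →L[ℂ] PolyFock n :=
  (basisIsometry _ (coordMap_injective i hφ)).toContinuousLinearMap

theorem ampliation_pureTensor {k : ℕ} {n : Fin k → ℕ} (i : Fin k)
    {φ : FreeMonoid (Fin (n i)) → FreeMonoid (Fin (n i))} (hφ : Function.Injective φ)
    (f : ∀ i, Fock (n i)) :
    ampliation i hφ (pureTensor f)
      = pureTensor (Function.update f i (basisIsometry φ hφ (f i))) := by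
  ext ω
  change Function.extend (fun γ : MultiWord n => Function.update γ i (φ (γ i)))
      (fun ω => ∏ l, f l (ω l)) 0 ω
    = ∏ l, (Function.update f i (basisIsometry φ hφ (f i)) l) (ω l)
  have hrest : ∀ γ : MultiWord n, ∏ l ∈ Finset.univ.erase i,
      (Function.update f i (basisIsometry φ hφ (f i)) l) (γ l)
        = ∏ l ∈ Finset.univ.erase i, f l (γ l) := fun γ =>
    Finset.prod_congr rfl fun l hl => by
      rw [Function.update_of_ne (Finset.ne_of_mem_erase hl)]
  rw [← Finset.mul_prod_erase _ _ (Finset.mem_univ i), hrest, Function.update_self]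
  change _ = Function.extend φ (f i) 0 (ω i) * _
  by_cases hx : ∃ α, φ α = ω i
  · obtain ⟨α, hα⟩ := hx
    have hω : ω = (fun γ : MultiWord n => Function.update γ i (φ (γ i)))
        (Function.update ω i α) := by simp [hα]
    conv_lhs => rw [hω]
    rw [(coordMap_injective i hφ).extend_apply, ← hα, hφ.extend_apply,
      ← Finset.mul_prod_erase _ _ (Finset.mem_univ i), Function.update_self]
    congr 1
    exact Finset.prod_congr rfl fun l hl => by
      rw [Function.update_of_ne (Finset.ne_of_mem_erase hl)]
  · rw [Function.extend_apply' _ _ _ hx, Function.extend_apply']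
    · simp
    · rintro ⟨γ, rfl⟩
      exact hx ⟨γ i, by simp⟩

/-- `𝐒_{i,j} = I ⊗ ⋯ ⊗ I ⊗ S_{i,j} ⊗ I ⊗ ⋯ ⊗ I` on `F²(H_{n₁}) ⊗ ⋯ ⊗ F²(H_{n_k})`. -/
def polyS {k : ℕ} (n : Fin k → ℕ) (i : Fin k) (j : Fin (n i)) : PolyFock n →L[ℂ] PolyFock n :=
  ampliation i (leftMul_injective j)

/-- `𝐑_{i,j} = I ⊗ ⋯ ⊗ I ⊗ R_{i,j} ⊗ I ⊗ ⋯ ⊗ I` on `F²(H_{n₁}) ⊗ ⋯ ⊗ F²(H_{n_k})`. -/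
def polyR {k : ℕ} (n : Fin k → ℕ) (i : Fin k) (j : Fin (n i)) : PolyFock n →L[ℂ] PolyFock n :=
  ampliation i (rightMul_injective j)

theorem polyS_pureTensor {k : ℕ} (n : Fin k → ℕ) (i : Fin k) (j : Fin (n i))
    (f : ∀ i, Fock (n i)) :
    polyS n i j (pureTensor f) = pureTensor (Function.update f i (leftCreation j (f i))) :=
  ampliation_pureTensor i (leftMul_injective j) f

theorem polyR_pureTensor {k : ℕ} (n : Fin k → ℕ) (i : Fin k) (j : Fin (n i))
    (f : ∀ i, Fock (n i)) :
    polyR n i j (pureTensor f) = pureTensor (Function.update f i (rightCreation j (f i))) :=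
  ampliation_pureTensor i (rightMul_injective j) f

/-- The polyball algebra `𝒜_𝐧`: the norm closed non-selfadjoint algebra generated by the `𝐒_{i,j}`
and the identity. -/
def polyballAlgebra {k : ℕ} (n : Fin k → ℕ) : Subalgebra ℂ (PolyFock n →L[ℂ] PolyFock n) :=
  (Algebra.adjoin ℂ {X | ∃ i j, X = polyS n i j}).topologicalClosure

/-! ### Multi-Toeplitz operators -/

/-- `A` on `E ⊗ F²(H_{n₁}) ⊗ ⋯ ⊗ F²(H_{n_k})` is `k`-multi-Toeplitz with respect to `𝐑` if
`(I_E ⊗ 𝐑_{i,s}^*) A (I_E ⊗ 𝐑_{i,t}) = δ_{st} A` for all `i` and `s, t`. -/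
def IsMultiToeplitz {E : Type*} [NormedAddCommGroup E] [InnerProductSpace ℂ E]
    {k : ℕ} (n : Fin k → ℕ)
    (A : HilbertTensor E (PolyFock n) →L[ℂ] HilbertTensor E (PolyFock n)) : Prop :=
  ∀ (i : Fin k) (s t : Fin (n i)),
    opTensor 1 (star (polyR n i s)) * A * opTensor 1 (polyR n i t) = if s = t then A else 0

/-- The scalar case: `T` on `F²(H_{n₁}) ⊗ ⋯ ⊗ F²(H_{n_k})` is `k`-multi-Toeplitz with respect to
`𝐑` if `𝐑_{i,s}^* T 𝐑_{i,t} = δ_{st} T` for all `i` and `s, t`. -/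
def IsScalarMultiToeplitz {k : ℕ} (n : Fin k → ℕ) (T : PolyFock n →L[ℂ] PolyFock n) : Prop :=
  ∀ (i : Fin k) (s t : Fin (n i)),
    star (polyR n i s) * T * polyR n i t = if s = t then T else 0

/-- `span {f^* g : f, g ∈ 𝒱}` for a set `𝒱` of operators on a Hilbert space. -/
def starMulSpan {K : Type*} [NormedAddCommGroup K] [InnerProductSpace ℂ K] [CompleteSpace K]
    (𝒱 : Set (K →L[ℂ] K)) : Set (K →L[ℂ] K) :=
  (Submodule.span ℂ {X | ∃ f ∈ 𝒱, ∃ g ∈ 𝒱, X = star f * g} : Submodule ℂ (K →L[ℂ] K))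

end

/-! View an operator as a matrix indexed by pairs of multi-words, with entries in `B(E)` (with `E =
ℂ` in the scalar case). One inclusion is soft. Elements of the algebra commute with the right
creation operators, and for fixed `i` these are isometries with orthogonal ranges, so every `f^* g`
is Toeplitz. The Toeplitz relations pass to weak limits (`star_mul_mul_of_mem_wotClosure`). For the
converse, the entries of a Toeplitz `A` do not change when a common suffix is stripped, and they
vanish if distinct last letters remain in some coordinate. Hence `A` is determined by its entries `C
α β` at reduced pairs, and formally `A = ∑ (I ⊗ S_β)^* (C α β ⊗ S_α)`. Partial sums of this series
are not uniformly bounded in general, so Fejér weights are inserted. This leaves finite sums of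
terms `f^* g` (`IsToeplitzMatrix.sum_reducedBox`). The weighting is a contraction, because the Fejér
kernel averages compressions `P_j A P_j` to windows of word lengths (`norm_fejer_sum_le`).
Boundedness and convergence of each column give strong convergence to `A` (`IsFejerMean.tendsto`).
Both cases of the theorem are instances of `toeplitz_eq_closures`. -/

noncomputable section

/-! ### Words -/

/-- Stripping the longest common suffix of two words leaves either an empty word or two words with
distinct last letters. -/
theorem FreeMonoid.exists_strip_suffix {X : Type*} (γ : FreeMonoid X) : ∀ δ : FreeMonoid X,
    (∃ α β c, (α = 1 ∨ β = 1) ∧ γ = α * c ∧ δ = β * c) ∨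
      ∃ γ' δ' s t c, s ≠ t ∧ γ = γ' * of s * c ∧ δ = δ' * of t * c := by
  have key : ∀ l m : List X, (∃ a b c : List X, (a = [] ∨ b = []) ∧ l = a ++ c ∧ m = b ++ c) ∨
      ∃ a b s t c, s ≠ t ∧ l = a ++ [s] ++ c ∧ m = b ++ [t] ++ c := by
    intro l
    induction l using List.reverseRecOn with
    | nil => exact fun m => Or.inl ⟨[], m, [], by simp⟩
    | append_singleton l s ih =>
      intro m
      obtain rfl | ⟨m, t, rfl⟩ := m.eq_nil_or_concat
      · exact Or.inl ⟨l ++ [s], [], [], by simp⟩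
      by_cases hst : s = t
      · subst hst
        obtain ⟨a, b, c, hab, rfl, rfl⟩ | ⟨a, b, p, q, c, hpq, rfl, rfl⟩ := ih m
        · exact Or.inl ⟨a, b, c ++ [s], hab, by simp, by simp⟩
        · exact Or.inr ⟨a, b, p, q, c ++ [s], hpq, by simp, by simp⟩
      · exact Or.inr ⟨l, m, s, t, [], hst, by simp, by simp⟩
  intro δ
  exact key γ δ

theorem FreeMonoid.mul_of_inj {X : Type*} {α β : FreeMonoid X} {s t : X}
    (h : α * of s = β * of t) : s = t := by
  have h' : toList α ++ [s] = toList β ++ [t] := h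
  simpa using (List.append_inj' h' rfl).2

/-- If the empty words sit on the same side, the equation is already the claim; otherwise one side
of it is empty, and lengths force all four words to be empty. -/
theorem FreeMonoid.reduced_unique {X : Type*} {α β α' β' : FreeMonoid X}
    (h : α = 1 ∨ β = 1) (h' : α' = 1 ∨ β' = 1) (e : α' * β = β' * α) : α' = α ∧ β' = β := by
  rcases h with rfl | rfl <;> rcases h' with rfl | rfl
  · simp_all
  · have := congrArg length e
    simp only [length_mul, length_one] at this
    have h1 : α' = 1 := length_eq_zero.1 (by omega)
    have h2 : β = 1 := length_eq_zero.1 (by omega)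
    simp [h1, h2]
  · have := congrArg length e
    simp only [length_mul, length_one] at this
    have h1 : β' = 1 := length_eq_zero.1 (by omega)
    have h2 : α = 1 := length_eq_zero.1 (by omega)
    simp [h1, h2]
  · simp_all

/-- Lets creation operators act on indices by multiplication in the product monoid, so that left and
right ones commute by associativity. -/
theorem Pi.mulSingle_mul_eq_update {ι : Type*} [DecidableEq ι] {M : ι → Type*} [∀ i, Monoid (M i)]
    (i : ι) (a : M i) (γ : ∀ i, M i) :
    Pi.mulSingle i a * γ = Function.update γ i (a * γ i) := by
  ext l
  by_cases hl : l = i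
  · subst hl; simp
  · simp [hl]

theorem Pi.mul_mulSingle_eq_update {ι : Type*} [DecidableEq ι] {M : ι → Type*} [∀ i, Monoid (M i)]
    (i : ι) (a : M i) (γ : ∀ i, M i) :
    γ * Pi.mulSingle i a = Function.update γ i (γ i * a) := by
  ext l
  by_cases hl : l = i
  · subst hl; simp
  · simp [hl]

/-! ### Multi-words, Toeplitz matrices and Fejér weights -/

section MultiWord

variable {k : ℕ} {n : Fin k → ℕ}

/-- The submonoid of multi-words that contains all letters is everything. -/
theorem MultiWord.induction_letters (H : Submonoid (MultiWord n))
    (h : ∀ i (j : Fin (n i)), (Pi.mulSingle i (FreeMonoid.of j) : MultiWord n) ∈ H)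
    (γ : MultiWord n) : γ ∈ H := by
  refine Submonoid.pi_mem_of_mulSingle_mem γ fun i => ?_
  induction γ i using FreeMonoid.recOn with
  | one => simp
  | of_mul x w hw => rw [Pi.mulSingle_mul]; exact H.mul_mem (h i x) hw

/-- A pair of multi-words is reduced if in each coordinate one of the two words is empty. -/
def MultiWord.Reduced (α β : MultiWord n) : Prop := ∀ i, α i = 1 ∨ β i = 1

/-- The Toeplitz condition for a scalar matrix indexed by multi-words. -/
def IsToeplitzMatrix (a : MultiWord n → MultiWord n → ℂ) : Prop :=
  ∀ i (s t : Fin (n i)) γ δ, a (γ * Pi.mulSingle i (FreeMonoid.of s))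
    (δ * Pi.mulSingle i (FreeMonoid.of t)) = if s = t then a γ δ else 0

theorem IsToeplitzMatrix.mul_right {a : MultiWord n → MultiWord n → ℂ} (ha : IsToeplitzMatrix a)
    (c γ δ : MultiWord n) : a (γ * c) (δ * c) = a γ δ := by
  let H : Submonoid (MultiWord n) :=
    { carrier := {c | ∀ γ δ, a (γ * c) (δ * c) = a γ δ}
      one_mem' := by simp
      mul_mem' := fun {c d} hc hd γ δ => by
        rw [← mul_assoc, ← mul_assoc, hd, hc] }
  exact MultiWord.induction_letters H (fun i j γ δ => by simp [ha i j j γ δ]) c γ δ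

/-- Cancelling `c` in coordinate `i` by `mul_right` exposes the distinct last letters `s` and `t`.
-/
theorem IsToeplitzMatrix.eq_zero {a : MultiWord n → MultiWord n → ℂ} (ha : IsToeplitzMatrix a)
    {γ δ : MultiWord n} {i : Fin k} {γ' δ' c : FreeMonoid (Fin (n i))} {s t : Fin (n i)}
    (hst : s ≠ t) (hγ : γ i = γ' * .of s * c) (hδ : δ i = δ' * .of t * c) : a γ δ = 0 := by
  have aux : ∀ (ε : MultiWord n) (ε' : FreeMonoid (Fin (n i))) (r : Fin (n i)),
      ε i = ε' * .of r * c → ε = Function.update ε i ε' * Pi.mulSingle i (FreeMonoid.of r)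
        * Pi.mulSingle i c := by
    intro ε ε' r h
    simp [Pi.mul_mulSingle_eq_update, ← h]
  rw [aux γ γ' s hγ, aux δ δ' t hδ, ha.mul_right, ha, if_neg hst]

/-- The Fejér weight of order `N` at a pair of multi-words. -/
def fejerWeight (N : ℕ) (γ δ : MultiWord n) : ℝ :=
  -- Natural subtraction truncates: for `N > 0` each factor is `max 0 (1 - d / N)`, where `d` is the
  -- difference of the two lengths.
  ∏ i, ((min (γ i).length (δ i).length + N - max (γ i).length (δ i).length : ℕ) : ℝ) / N

theorem fejerWeight_nonneg (N : ℕ) (γ δ : MultiWord n) : 0 ≤ fejerWeight N γ δ :=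
  Finset.prod_nonneg fun _ _ => by positivity

theorem fejerWeight_le_one (N : ℕ) (γ δ : MultiWord n) : fejerWeight N γ δ ≤ 1 := by
  refine Finset.prod_le_one (fun _ _ => by positivity) fun i _ => ?_
  refine div_le_one_of_le₀ ?_ (by positivity)
  exact_mod_cast (by omega)

theorem fejerWeight_mul_right (N : ℕ) (γ δ c : MultiWord n) :
    fejerWeight N (γ * c) (δ * c) = fejerWeight N γ δ := by
  refine Finset.prod_congr rfl fun i _ => ?_
  simp only [Pi.mul_apply, FreeMonoid.length_mul]
  congr 2
  omega

/-- In a reduced pair the length difference in a coordinate is the longer length, so only finitely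
many reduced pairs carry weight. -/
theorem fejerWeight_eq_zero {N : ℕ} {γ δ : MultiWord n} (h : γ.Reduced δ) {i : Fin k}
    (hi : N ≤ (γ i).length ∨ N ≤ (δ i).length) : fejerWeight N γ δ = 0 := by
  refine Finset.prod_eq_zero (Finset.mem_univ i) ?_
  have : min (γ i).length (δ i).length + N - max (γ i).length (δ i).length = 0 := by
    rcases h i with h | h <;> rw [h] at hi ⊢ <;> simp only [FreeMonoid.length_one] at hi ⊢ <;> omega
  rw [this]; simp

theorem tendsto_fejerWeight (γ δ : MultiWord n) :
    Filter.Tendsto (fun N => fejerWeight N γ δ) Filter.atTop (nhds 1) := by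
  have : ∀ p q : ℕ, Filter.Tendsto (fun N : ℕ => ((p + N - q : ℕ) : ℝ) / N) Filter.atTop (nhds 1) := by
    intro p q
    have h : Filter.Tendsto (fun N : ℕ => 1 + ((p : ℝ) - q) / N) Filter.atTop (nhds (1 + 0)) :=
      tendsto_const_nhds.add (tendsto_const_div_atTop_nhds_zero_nat _)
    rw [add_zero] at h
    refine h.congr' ?_
    filter_upwards [Filter.eventually_ge_atTop (q + 1)] with N hN
    rw [Nat.cast_sub (by omega), Nat.cast_add]
    have : (N : ℝ) ≠ 0 := by exact_mod_cast (by omega)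
    field_simp
    ring
  simpa only [fejerWeight, Finset.prod_const_one] using tendsto_finsetProd (f := fun i (N : ℕ) =>
    ((min (γ i).length (δ i).length + N - max (γ i).length (δ i).length : ℕ) : ℝ) / N)
    Finset.univ fun i _ => this _ _

theorem MultiWord.finite_box (n : Fin k → ℕ) (N : ℕ) :
    {γ : MultiWord n | ∀ i, (γ i).length < N}.Finite :=
  (Set.Finite.pi' fun i => List.finite_length_lt (Fin (n i)) N).subset fun _ h i => h i

theorem MultiWord.finite_reducedBox (n : Fin k → ℕ) (N : ℕ) :
    {p : MultiWord n × MultiWord n | p.1.Reduced p.2 ∧ (∀ i, (p.1 i).length < N) ∧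
      ∀ i, (p.2 i).length < N}.Finite :=
  ((finite_box n N).prod (finite_box n N)).subset fun _ h => h.2

/-- The finite set of reduced pairs of multi-words with all lengths `< N`. -/
def MultiWord.reducedBox (n : Fin k → ℕ) (N : ℕ) : Finset (MultiWord n × MultiWord n) :=
  (finite_reducedBox n N).toFinset

theorem MultiWord.mem_reducedBox {N : ℕ} {p : MultiWord n × MultiWord n} :
    p ∈ reducedBox n N ↔ p.1.Reduced p.2 ∧ (∀ i, (p.1 i).length < N) ∧
      ∀ i, (p.2 i).length < N := by
  simp [reducedBox]

open Classical in
/-- The Fejér mean of a Toeplitz matrix as a finite sum over reduced pairs. -/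
theorem IsToeplitzMatrix.sum_reducedBox {a : MultiWord n → MultiWord n → ℂ}
    (ha : IsToeplitzMatrix a) (N : ℕ) (γ δ : MultiWord n) :
    ∑ p ∈ MultiWord.reducedBox n N,
      (if p.2 * γ = p.1 * δ then (fejerWeight N p.1 p.2 : ℂ) * a p.1 p.2 else 0)
        = fejerWeight N γ δ * a γ δ := by
  -- Either the pair reduces in every coordinate, and only the reduced form `(α, β)` can contribute,
  -- or distinct last letters survive somewhere and both sides vanish.
  by_cases h : ∃ α β c : MultiWord n, α.Reduced β ∧ γ = α * c ∧ δ = β * c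
  · obtain ⟨α, β, c, hr, rfl, rfl⟩ := h
    have hu : ∀ p : MultiWord n × MultiWord n, p.1.Reduced p.2 →
        (p.2 * (α * c) = p.1 * (β * c) ↔ p = (α, β)) := by
      intro p hp
      constructor
      · intro e
        have e' : p.1 * β = p.2 * α := mul_right_cancel (b := c) (by simpa [mul_assoc] using e.symm)
        have := fun i => FreeMonoid.reduced_unique (hr i) (hp i) (congrFun e' i)
        exact Prod.ext (funext fun i => (this i).1) (funext fun i => (this i).2)
      · rintro rfl
        rw [← mul_assoc, ← mul_assoc]
        congr 1
        funext i
        rcases hr i with h | h <;> simp [h]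
    rw [fejerWeight_mul_right, ha.mul_right]
    by_cases hm : (α, β) ∈ MultiWord.reducedBox n N
    · rw [Finset.sum_eq_single_of_mem _ hm, if_pos ((hu (α, β) hr).2 rfl)]
      intro p hp hne
      rw [if_neg fun e => hne ((hu p (MultiWord.mem_reducedBox.1 hp).1).1 e)]
    · rw [Finset.sum_eq_zero]
      · rw [MultiWord.mem_reducedBox] at hm
        simp only [not_and_or, not_forall, not_lt] at hm
        rcases hm with hm | ⟨i, hi⟩ | ⟨i, hi⟩
        · exact absurd hr hm
        · rw [fejerWeight_eq_zero hr (Or.inl hi)]; simp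
        · rw [fejerWeight_eq_zero hr (Or.inr hi)]; simp
      · intro p hp
        refine if_neg fun e => hm ?_
        rwa [← (hu p (MultiWord.mem_reducedBox.1 hp).1).1 e]
  · have hi : ∃ i, ¬ ∃ α β c, (α = 1 ∨ β = 1) ∧ γ i = α * c ∧ δ i = β * c := by
      by_contra! H
      choose α β c H using H
      exact h ⟨α, β, c, fun i => (H i).1, funext fun i => (H i).2.1, funext fun i => (H i).2.2⟩
    obtain ⟨i, hi⟩ := hi
    obtain ⟨γ', δ', s, t, c, hst, hγ, hδ⟩ :=
      (FreeMonoid.exists_strip_suffix (γ i) (δ i)).resolve_left hi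
    rw [ha.eq_zero hst hγ hδ, mul_zero]
    -- After cancelling `c`, the two sides of `p.2 * γ = p.1 * δ` end in `s` and `t` in coordinate
    -- `i`.
    refine Finset.sum_eq_zero fun p hp => if_neg fun e => hst ?_
    have e' := congrFun e i
    simp only [Pi.mul_apply, hγ, hδ, ← mul_assoc] at e'
    have e'' := mul_right_cancel e'
    exact FreeMonoid.mul_of_inj e''

end MultiWord
end

noncomputable section

/-! ### Fejér means of operators -/

section Fejer

variable {k : ℕ} {n : Fin k → ℕ}

/-- The indicator function of the multi-words whose lengths lie in the window `(j - N, j]`. -/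
def windowIndicator (N : ℕ) (j : Fin k → ℕ) (γ : MultiWord n) : ℝ :=
  ∏ i, if (γ i).length ≤ j i ∧ j i < (γ i).length + N then 1 else 0

/-- In each coordinate the sum counts the overlap of two integer intervals of length `N`. It
suffices that `L` contains the window of `γ`, since the overlap lies inside it. -/
theorem sum_windowIndicator_mul {N L : ℕ} (hN : N ≠ 0) {γ : MultiWord n}
    (hL : ∀ i, (γ i).length + N ≤ L) (δ : MultiWord n) :
    ∑ j ∈ Fintype.piFinset fun _ : Fin k => Finset.range L,
      windowIndicator N j γ * windowIndicator N j δ = (N : ℝ) ^ k * fejerWeight N γ δ := by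
  have h1 : ∀ i, ∑ x ∈ Finset.range L,
      ((if (γ i).length ≤ x ∧ x < (γ i).length + N then (1 : ℝ) else 0)
        * if (δ i).length ≤ x ∧ x < (δ i).length + N then 1 else 0)
      = ((min (γ i).length (δ i).length + N - max (γ i).length (δ i).length : ℕ) : ℝ) := by
    intro i
    have hf : (Finset.range L).filter (fun x => ((γ i).length ≤ x ∧ x < (γ i).length + N) ∧
        ((δ i).length ≤ x ∧ x < (δ i).length + N))
        = Finset.Ico (max (γ i).length (δ i).length) (min (γ i).length (δ i).length + N) := by
      ext x
      have := hL i
      simp only [Finset.mem_filter, Finset.mem_range, Finset.mem_Ico]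
      omega
    simp_rw [ite_zero_mul_ite_zero, one_mul]
    rw [Finset.sum_boole, hf, Nat.card_Ico]
  simp_rw [windowIndicator, ← Finset.prod_mul_distrib]
  rw [← Finset.prod_univ_sum (fun _ : Fin k => Finset.range L) (fun i x =>
      (if (γ i).length ≤ x ∧ x < (γ i).length + N then (1 : ℝ) else 0)
        * if (δ i).length ≤ x ∧ x < (δ i).length + N then 1 else 0), Finset.prod_congr rfl
    fun i _ => h1 i, fejerWeight, Finset.prod_div_distrib, Finset.prod_const, Finset.card_univ,
    Fintype.card_fin, mul_div_cancel₀]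
  positivity

theorem fejerWeight_self {N : ℕ} (hN : N ≠ 0) (γ : MultiWord n) : fejerWeight N γ γ = 1 := by
  have : (N : ℝ) ≠ 0 := by exact_mod_cast hN
  simp [fejerWeight, this]

variable {E K : Type*} [NormedAddCommGroup E] [InnerProductSpace ℂ E]
  [NormedAddCommGroup K] [InnerProductSpace ℂ K] {J : MultiWord n → E →ₗᵢ[ℂ] K}

/-- Pythagoras, together with the fact that every multi-word in `s` lies in exactly `N ^ k` windows.
-/
theorem sum_norm_window_sq (hJ : OrthogonalFamily ℂ (fun _ : MultiWord n => E) J) {N L : ℕ}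
    (hN : N ≠ 0) (s : Finset (MultiWord n)) (hL : ∀ γ ∈ s, ∀ i, (γ i).length + N ≤ L)
    (x : MultiWord n → E) :
    ∑ j ∈ Fintype.piFinset fun _ : Fin k => Finset.range L,
      ‖∑ γ ∈ s, J γ ((windowIndicator N j γ : ℂ) • x γ)‖ ^ 2
        = (N : ℝ) ^ k * ‖∑ γ ∈ s, J γ (x γ)‖ ^ 2 := by
  simp_rw [hJ.norm_sum, norm_smul, mul_pow]
  rw [Finset.sum_comm, Finset.mul_sum]
  refine Finset.sum_congr rfl fun γ hγ => ?_
  rw [← Finset.sum_mul]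
  congr 1
  have := sum_windowIndicator_mul hN (hL γ hγ) γ
  rw [fejerWeight_self hN, mul_one] at this
  simp_rw [← this, Complex.norm_real, Real.norm_eq_abs, sq_abs, sq]

theorem norm_fejer_sum_le (hJ : OrthogonalFamily ℂ (fun _ : MultiWord n => E) J)
    (A : K →L[ℂ] K) (N : ℕ) (hN : N ≠ 0) (s : Finset (MultiWord n)) (x y : MultiWord n → E) :
    ‖∑ γ ∈ s, ∑ δ ∈ s, (fejerWeight N γ δ : ℂ) * inner ℂ (J γ (y γ)) (A (J δ (x δ)))‖
      ≤ ‖A‖ * (‖∑ γ ∈ s, J γ (y γ)‖ * ‖∑ γ ∈ s, J γ (x γ)‖) := by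
  -- Any bound serves here; the sum of all the lengths shifted by `N` is a convenient one.
  obtain ⟨L, hL⟩ : ∃ L, ∀ γ ∈ s, ∀ i, (γ i).length + N ≤ L := by
    refine ⟨∑ γ ∈ s, ∑ i, ((γ i).length + N), fun γ hγ i => ?_⟩
    exact (Finset.single_le_sum (f := fun i => (γ i).length + N) (fun _ _ => Nat.zero_le _)
      (Finset.mem_univ i)).trans (Finset.single_le_sum
        (f := fun γ : MultiWord n => ∑ i, ((γ i).length + N)) (fun _ _ => Nat.zero_le _) hγ)
  set B := Fintype.piFinset fun _ : Fin k => Finset.range L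
  set u : (Fin k → ℕ) → K := fun j => ∑ γ ∈ s, J γ ((windowIndicator N j γ : ℂ) • x γ) with hu
  set v : (Fin k → ℕ) → K := fun j => ∑ γ ∈ s, J γ ((windowIndicator N j γ : ℂ) • y γ) with hv
  have hpos : (0 : ℝ) < (N : ℝ) ^ k := by positivity
  -- The weighted form is an average of the forms of `A` on windowed vectors; Cauchy–Schwarz over
  -- the windows then bounds it by `‖A‖`.
  have hsum : ((N : ℝ) ^ k : ℂ) * ∑ γ ∈ s, ∑ δ ∈ s,
      (fejerWeight N γ δ : ℂ) * inner ℂ (J γ (y γ)) (A (J δ (x δ)))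
      = ∑ j ∈ B, inner ℂ (v j) (A (u j)) := by
    simp_rw [hu, hv, map_sum, sum_inner, inner_sum, map_smul, inner_smul_left, inner_smul_right,
      Complex.conj_ofReal]
    rw [Finset.mul_sum, Finset.sum_comm]
    refine Finset.sum_congr rfl fun γ hγ => ?_
    rw [Finset.mul_sum, Finset.sum_comm]
    refine Finset.sum_congr rfl fun δ _ => ?_
    simp_rw [← mul_assoc, ← Finset.sum_mul]
    congr 1
    exact_mod_cast (sum_windowIndicator_mul hN (hL γ hγ) δ).symm
  have hb : ‖∑ j ∈ B, inner ℂ (v j) (A (u j))‖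
      ≤ ‖A‖ * (√(∑ j ∈ B, ‖v j‖ ^ 2) * √(∑ j ∈ B, ‖u j‖ ^ 2)) := by
    calc ‖∑ j ∈ B, inner ℂ (v j) (A (u j))‖ ≤ ∑ j ∈ B, ‖A‖ * (‖v j‖ * ‖u j‖) := by
          refine norm_sum_le_of_le _ fun j _ => (norm_inner_le_norm _ _).trans ?_
          rw [mul_left_comm]
          exact mul_le_mul_of_nonneg_left (A.le_opNorm _) (norm_nonneg _)
      _ = ‖A‖ * ∑ j ∈ B, ‖v j‖ * ‖u j‖ := by rw [Finset.mul_sum]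
      _ ≤ _ := mul_le_mul_of_nonneg_left (Real.sum_mul_le_sqrt_mul_sqrt _ _ _) (norm_nonneg _)
  rw [sum_norm_window_sq hJ hN s hL, sum_norm_window_sq hJ hN s hL, Real.sqrt_mul hpos.le,
    Real.sqrt_mul hpos.le, Real.sqrt_sq (norm_nonneg _), Real.sqrt_sq (norm_nonneg _), ← hsum,
    norm_mul, mul_mul_mul_comm, Real.mul_self_sqrt hpos.le, mul_left_comm] at hb
  have hn : ‖((N : ℝ) ^ k : ℂ)‖ = (N : ℝ) ^ k := by simp
  rw [hn] at hb
  exact le_of_mul_le_mul_left hb hpos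

theorem ContinuousLinearMap.tendsto_of_norm_le_of_hasSum {ι : Type*} {A : K →L[ℂ] K}
    {X : ℕ → K →L[ℂ] K} (hX : ∀ N, ‖X N‖ ≤ ‖A‖) {f : ι → K} {u : K} (hf : HasSum f u)
    (h : ∀ i, Filter.Tendsto (fun N => X N (f i)) Filter.atTop (nhds (A (f i)))) :
    Filter.Tendsto (fun N => X N u) Filter.atTop (nhds (A u)) := by
  rw [Metric.tendsto_atTop]
  intro ε hε
  -- The `+ 1` keeps the denominator positive when `A = 0`.
  obtain ⟨s, hs⟩ := (Metric.tendsto_nhds.1 hf (ε / (3 * (‖A‖ + 1))) (by positivity)).exists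
  set w := ∑ i ∈ s, f i
  have hw : Filter.Tendsto (fun N => X N w) Filter.atTop (nhds (A w)) := by
    simp only [w, map_sum]
    exact tendsto_finsetSum _ fun i _ => h i
  obtain ⟨N₀, hN₀⟩ := Metric.tendsto_atTop.1 hw (ε / 3) (by positivity)
  refine ⟨N₀, fun N hN => ?_⟩
  have hb : ∀ T : K →L[ℂ] K, ‖T‖ ≤ ‖A‖ → dist (T w) (T u) < ε / 3 := by
    intro T hT
    rw [dist_eq_norm, ← map_sub]
    rw [dist_eq_norm, lt_div_iff₀ (by positivity)] at hs
    have := T.le_of_opNorm_le hT (w - u)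
    nlinarith [norm_nonneg (w - u), norm_nonneg A]
  calc dist (X N u) (A u) ≤ dist (X N u) (X N w) + dist (X N w) (A w) + dist (A w) (A u) :=
        dist_triangle4 _ _ _ _
    _ < ε / 3 + ε / 3 + ε / 3 := by
        rw [dist_comm (X N u)]
        exact add_lt_add (add_lt_add (hb _ (hX N)) (hN₀ N hN)) (hb A le_rfl)
    _ = ε := by ring

variable [CompleteSpace K]

theorem IsHilbertSum.hasSum_coeff {ι : Type*} {V : ι → E →ₗᵢ[ℂ] K}
    (hV : IsHilbertSum ℂ (fun _ : ι => E) V) (u : K) :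
    HasSum (fun i => V i (hV.linearIsometryEquiv u i)) u := by
  simpa using hV.hasSum_linearIsometryEquiv_symm (hV.linearIsometryEquiv u)

theorem IsHilbertSum.inner_coeff {ι : Type*} {V : ι → E →ₗᵢ[ℂ] K}
    (hV : IsHilbertSum ℂ (fun _ : ι => E) V) (i : ι) (y : E) (u : K) :
    inner ℂ y (hV.linearIsometryEquiv u i) = inner ℂ (V i y) u := by
  classical
  rw [← hV.linearIsometryEquiv.inner_map_map, ← hV.linearIsometryEquiv_symm_apply_single y,
    LinearIsometryEquiv.apply_symm_apply, lp.inner_single_left]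

theorem IsHilbertSum.hasSum_norm_coeff_sq {ι : Type*} {V : ι → E →ₗᵢ[ℂ] K}
    (hV : IsHilbertSum ℂ (fun _ : ι => E) V) (u : K) :
    HasSum (fun i => ‖hV.linearIsometryEquiv u i‖ ^ 2) (‖u‖ ^ 2) := by
  have := lp.hasSum_norm (p := 2) (by norm_num) (hV.linearIsometryEquiv u)
  simpa using this

/-- `X` is the Schur product of `A` with the Fejér kernel of order `N`. -/
def IsFejerMean (J : MultiWord n → E →ₗᵢ[ℂ] K) (N : ℕ) (A X : K →L[ℂ] K) : Prop :=
  ∀ γ δ x y, inner ℂ (J γ y) (X (J δ x))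
    = (fejerWeight N γ δ : ℂ) * inner ℂ (J γ y) (A (J δ x))

/-- The bound of `norm_fejer_sum_le` on finite sections passes to the limit in both vectors of the
sesquilinear form. -/
theorem IsFejerMean.norm_le (hJ : IsHilbertSum ℂ (fun _ : MultiWord n => E) J) {N : ℕ}
    (hN : N ≠ 0) {A X : K →L[ℂ] K} (h : IsFejerMean J N A X) : ‖X‖ ≤ ‖A‖ := by
  have key : ∀ u v, ‖(inner ℂ v (X u) : ℂ)‖ ≤ ‖A‖ * (‖v‖ * ‖u‖) := by
    intro u v
    have hu := hJ.hasSum_coeff u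
    have hv := hJ.hasSum_coeff v
    refine le_of_tendsto_of_tendsto' (hv.inner ((X.continuous.tendsto u).comp hu)).norm
      ((hv.norm.mul hu.norm).const_mul ‖A‖) fun s => ?_
    refine le_of_eq_of_le ?_ (norm_fejer_sum_le hJ.OrthogonalFamily A N hN s _ _)
    rw [Finset.sum_comm]
    simp only [Function.comp_apply, map_sum, sum_inner, inner_sum, h _ _ _ _]
  refine X.opNorm_le_bound (norm_nonneg _) fun u => ?_
  have := key u (X u)
  rw [inner_self_eq_norm_sq_to_K] at this
  rcases (norm_nonneg (X u)).eq_or_lt with h0 | h0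
  · rw [← h0]; positivity
  · refine le_of_mul_le_mul_left ?_ h0
    calc ‖X u‖ * ‖X u‖ = ‖((‖X u‖ : ℂ)) ^ 2‖ := by simp [sq]
      _ ≤ _ := this
      _ = _ := by ring

theorem IsFejerMean.coeff (hJ : IsHilbertSum ℂ (fun _ : MultiWord n => E) J) {N : ℕ}
    {A X : K →L[ℂ] K} (h : IsFejerMean J N A X) (γ δ : MultiWord n) (x : E) :
    hJ.linearIsometryEquiv (X (J δ x)) γ
      = (fejerWeight N γ δ : ℂ) • hJ.linearIsometryEquiv (A (J δ x)) γ := by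
  refine ext_inner_left ℂ fun y => ?_
  rw [inner_smul_right, hJ.inner_coeff, hJ.inner_coeff, h]

/-- Column `δ` of the error is that of `A` times `fejerWeight - 1`, which tends to `0` pointwise and
is bounded by `1`; dominated convergence applies to the square-summable column. The order is `N + 1`
because `norm_le` needs a nonzero order. -/
theorem IsFejerMean.tendsto_single (hJ : IsHilbertSum ℂ (fun _ : MultiWord n => E) J)
    {A : K →L[ℂ] K} {X : ℕ → K →L[ℂ] K} (h : ∀ N, IsFejerMean J (N + 1) A (X N))
    (δ : MultiWord n) (x : E) :
    Filter.Tendsto (fun N => X N (J δ x)) Filter.atTop (nhds (A (J δ x))) := by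
  rw [tendsto_iff_norm_sub_tendsto_zero]
  have hsq : Filter.Tendsto (fun N => ‖X N (J δ x) - A (J δ x)‖ ^ 2) Filter.atTop (nhds 0) := by
    have hs := hJ.hasSum_norm_coeff_sq (A (J δ x))
    have hN : ∀ N γ, ‖hJ.linearIsometryEquiv (X N (J δ x) - A (J δ x)) γ‖ ^ 2
        = (fejerWeight (N + 1) γ δ - 1) ^ 2 * ‖hJ.linearIsometryEquiv (A (J δ x)) γ‖ ^ 2 := by
      intro N γ
      rw [map_sub, lp.coeFn_sub, Pi.sub_apply, (h N).coeff hJ, sub_eq_add_neg,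
        ← neg_one_smul ℂ, ← add_smul, ← sub_eq_add_neg, norm_smul, mul_pow]
      congr 1
      rw [← Complex.ofReal_one, ← Complex.ofReal_sub, Complex.norm_real, Real.norm_eq_abs, sq_abs]
    simp_rw [← (hJ.hasSum_norm_coeff_sq _).tsum_eq, hN]
    rw [← tsum_zero (α := ℝ) (β := MultiWord n)]
    refine tendsto_tsum_of_dominated_convergence hs.summable (fun γ => ?_)
      (Filter.Eventually.of_forall fun N γ => ?_)
    · have h1 := ((Filter.tendsto_add_atTop_iff_nat 1).2 (tendsto_fejerWeight γ δ)).sub_const 1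
      simpa using (h1.pow 2).mul_const (‖hJ.linearIsometryEquiv (A (J δ x)) γ‖ ^ 2)
    · rw [Real.norm_of_nonneg (by positivity)]
      have h0 := fejerWeight_nonneg (N + 1) γ δ
      have h1 := fejerWeight_le_one (N + 1) γ δ
      exact mul_le_of_le_one_left (by positivity) (by nlinarith)
  simpa using hsq.sqrt

theorem IsFejerMean.tendsto (hJ : IsHilbertSum ℂ (fun _ : MultiWord n => E) J)
    {A : K →L[ℂ] K} {X : ℕ → K →L[ℂ] K} (h : ∀ N, IsFejerMean J (N + 1) A (X N)) (u : K) :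
    Filter.Tendsto (fun N => X N u) Filter.atTop (nhds (A u)) :=
  ContinuousLinearMap.tendsto_of_norm_le_of_hasSum (fun N => (h N).norm_le hJ N.succ_ne_zero)
    (hJ.hasSum_coeff u) fun δ => tendsto_single hJ h δ _

variable [CompleteSpace E]

/-- If a set of operators contains enough weighted left shifts, the strong closure of the span of
the `f^* g` contains every operator with Toeplitz matrix coefficients. -/
theorem mem_sotClosure_starMulSpan (hJ : IsHilbertSum ℂ (fun _ : MultiWord n => E) J)
    {𝒱 : Set (K →L[ℂ] K)}
    (h𝒱 : ∀ (α : MultiWord n) (B : E →L[ℂ] E), ∃ g ∈ 𝒱, ∀ γ x, g (J γ x) = J (α * γ) (B x))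
    {A : K →L[ℂ] K}
    (hA : ∀ x y, IsToeplitzMatrix fun γ δ : MultiWord n => inner ℂ (J γ y) (A (J δ x))) :
    A ∈ sotClosure (starMulSpan 𝒱) := by
  classical
  choose g hg𝒱 hg using h𝒱
  -- `C α β` is the operator entry of `A`. The term of `X N` at `(α, β)` has nonzero entries only
  -- where `β * γ = α * δ`, the condition in `sum_reducedBox`.
  let C : MultiWord n → MultiWord n → E →L[ℂ] E := fun α β =>
    (ContinuousLinearMap.adjoint (J α).toContinuousLinearMap) ∘L A ∘L (J β).toContinuousLinearMap
  let X : ℕ → K →L[ℂ] K := fun N => ∑ p ∈ MultiWord.reducedBox n (N + 1),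
    (fejerWeight (N + 1) p.1 p.2 : ℂ) • (star (g p.2 1) * g p.1 (C p.1 p.2))
  have hinner : ∀ γ δ x y, inner ℂ (J γ y) (J δ x) = if γ = δ then inner ℂ y x else 0 := by
    intro γ δ x y
    split_ifs with h
    · subst h; exact (J γ).inner_map_map y x
    · exact hJ.OrthogonalFamily h y x
  have hX : ∀ N, IsFejerMean J (N + 1) A (X N) := by
    intro N γ δ x y
    rw [← (hA x y).sum_reducedBox]
    simp only [X, sum_apply, inner_sum, smul_apply,
      inner_smul_right, mul_apply_eq_comp, ContinuousLinearMap.star_eq_adjoint,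
      ContinuousLinearMap.adjoint_inner_right, hg, hinner, one_apply_eq_self]
    refine Finset.sum_congr rfl fun p _ => ?_
    rw [mul_ite, mul_zero]
    simp [C, ContinuousLinearMap.adjoint_inner_right]
  have ht : Filter.Tendsto (fun N =>
      ContinuousLinearMap.toPointwiseConvergenceCLM ℂ (RingHom.id ℂ) K K (X N)) Filter.atTop
      (nhds (ContinuousLinearMap.toPointwiseConvergenceCLM ℂ (RingHom.id ℂ) K K A)) :=
    PointwiseConvergenceCLM.tendsto_iff_forall_tendsto.2 fun u => IsFejerMean.tendsto hJ hX u
  have hmem : ∀ N, X N ∈ starMulSpan 𝒱 := fun N => Submodule.sum_mem _ fun p _ =>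
    Submodule.smul_mem _ _ (Submodule.subset_span ⟨_, hg𝒱 _ _, _, hg𝒱 _ _, rfl⟩)
  rw [sotClosure, Set.mem_ofPred_eq]
  exact mem_closure_of_tendsto ht
    (Filter.Eventually.of_forall fun N => Set.mem_image_of_mem _ (hmem N))

end Fejer
end

noncomputable section

/-! ### Operator topologies -/

section Topologies

variable {K : Type*} [NormedAddCommGroup K] [InnerProductSpace ℂ K] [CompleteSpace K]

theorem sotClosure_subset_wotClosure (M : Set (K →L[ℂ] K)) : sotClosure M ⊆ wotClosure M := by
  intro T hT
  let F : PointwiseConvergenceCLM (RingHom.id ℂ) K K → (K →WOT[ℂ] K) :=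
    fun T => ContinuousLinearMapWOT.ofCLM T
  have hF : Continuous F := by
    rw [ContinuousLinearMapWOT.continuous_iff]
    intro x y
    exact continuous_const.inner
      (PointwiseConvergenceCLM.continuousEvalConst.continuous_eval_const x)
  rw [sotClosure, Set.mem_ofPred_eq] at hT
  have hmaps : Set.MapsTo F
      (ContinuousLinearMap.toPointwiseConvergenceCLM ℂ (RingHom.id ℂ) K K '' M)
      ((ContinuousLinearMapWOT.ofCLM : (K →L[ℂ] K) → (K →WOT[ℂ] K)) '' M) := by
    rintro _ ⟨S, hS, rfl⟩
    exact ⟨S, hS, rfl⟩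
  exact map_mem_closure (X := PointwiseConvergenceCLM (RingHom.id ℂ) K K) hF hT hmaps

/-- Moving `P` to the other side of the inner product turns the relation into equations between
matrix coefficients of `T`, which are weakly continuous. -/
theorem mul_mul_eq_smul_of_mem_wotClosure {M : Set (K →L[ℂ] K)} {P Q : K →L[ℂ] K} {c : ℂ}
    (hM : ∀ T ∈ M, P * T * Q = c • T) {T : K →L[ℂ] K} (hT : T ∈ wotClosure M) :
    P * T * Q = c • T := by
  refine ContinuousLinearMap.ext fun x => ext_inner_left ℂ fun y => ?_
  have hclosed : IsClosed {S : K →WOT[ℂ] K |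
      inner ℂ (ContinuousLinearMap.adjoint P y) (S (Q x)) = c * inner ℂ y (S x)} := by
    have h := ContinuousLinearMapWOT.continuous_iff.1
      (continuous_id : Continuous (id : (K →WOT[ℂ] K) → (K →WOT[ℂ] K)))
    exact isClosed_eq (h _ _) (continuous_const.mul (h _ _))
  have hsub : ((ContinuousLinearMapWOT.ofCLM : (K →L[ℂ] K) → (K →WOT[ℂ] K)) '' M) ⊆
      {S : K →WOT[ℂ] K |
        inner ℂ (ContinuousLinearMap.adjoint P y) (S (Q x)) = c * inner ℂ y (S x)} := by
    rintro _ ⟨S, hS, rfl⟩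
    have := congrArg (fun A : K →L[ℂ] K => inner ℂ y (A x)) (hM S hS)
    simpa [ContinuousLinearMap.adjoint_inner_left, inner_smul_right] using this
  have := closure_minimal hsub hclosed hT
  simpa [ContinuousLinearMap.adjoint_inner_left, inner_smul_right] using this

/-- Operators in the weak closure of the span of the `f^* g` are Toeplitz with respect to every
family of isometries with orthogonal ranges that commutes with all `f`. -/
theorem star_mul_mul_of_mem_wotClosure {ι : Type*} [DecidableEq ι] {V : ι → K →L[ℂ] K}
    (hV : ∀ s t, star (V s) * V t = if s = t then 1 else 0) {𝒱 : Set (K →L[ℂ] K)}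
    (h𝒱 : ∀ f ∈ 𝒱, ∀ s, Commute f (V s)) {T : K →L[ℂ] K} (hT : T ∈ wotClosure (starMulSpan 𝒱))
    (s t : ι) : star (V s) * T * V t = if s = t then T else 0 := by
  have key : ∀ S ∈ starMulSpan 𝒱,
      star (V s) * S * V t = (if s = t then (1 : ℂ) else 0) • S := by
    intro S hS
    refine Submodule.span_induction (p := fun S _ =>
      star (V s) * S * V t = (if s = t then (1 : ℂ) else 0) • S) ?_ ?_ ?_ ?_ hS
    · rintro _ ⟨f, hf, g, hg, rfl⟩
      calc star (V s) * (star f * g) * V t = star (f * V s) * (g * V t) := by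
            rw [star_mul]; simp only [mul_assoc]
        _ = star f * (star (V s) * V t) * g := by
            rw [(h𝒱 f hf s).eq, (h𝒱 g hg t).eq, star_mul]; simp only [mul_assoc]
        _ = _ := by rw [hV]; split_ifs <;> simp
    · simp
    · intro x y _ _ hx hy
      rw [mul_add, add_mul, hx, hy, smul_add]
    · intro c x _ hx
      rw [mul_smul_comm, smul_mul_assoc, hx, smul_comm]
  rw [mul_mul_eq_smul_of_mem_wotClosure key hT]
  split_ifs <;> simp

end Topologies

/-! ### Toeplitz operators for an abstract family of right shifts -/

section Abstract

variable {k : ℕ} {n : Fin k → ℕ}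
variable {E K : Type*} [NormedAddCommGroup E] [InnerProductSpace ℂ E]
  [NormedAddCommGroup K] [InnerProductSpace ℂ K] [CompleteSpace K]

theorem IsHilbertSum.clm_ext {ι : Type*} {J : ι → E →ₗᵢ[ℂ] K}
    (hJ : IsHilbertSum ℂ (fun _ : ι => E) J) {S T : K →L[ℂ] K}
    (h : ∀ i x, S (J i x) = T (J i x)) : S = T := by
  ext u
  have hS := (hJ.hasSum_coeff u).mapL S
  have hT := (hJ.hasSum_coeff u).mapL T
  simp only [h] at hS
  exact hS.unique hT

theorem IsHilbertSum.inner_eq {ι : Type*} [DecidableEq ι] {J : ι → E →ₗᵢ[ℂ] K}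
    (hJ : IsHilbertSum ℂ (fun _ : ι => E) J) (i j : ι) (x y : E) :
    inner ℂ (J i y) (J j x) = if i = j then inner ℂ y x else 0 := by
  split_ifs with h
  · subst h; exact (J i).inner_map_map y x
  · exact hJ.OrthogonalFamily h y x

variable [CompleteSpace E] {J : MultiWord n → E →ₗᵢ[ℂ] K}

/-- The operators that are Toeplitz with respect to a family of right shifts form the strong and the
weak closure of the span of the `f^* g`, provided that the `f` commute with the right shifts and
that all weighted left shifts occur among them. -/
theorem toeplitz_eq_closures (hJ : IsHilbertSum ℂ (fun _ : MultiWord n => E) J)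
    {V : ∀ i, Fin (n i) → K →L[ℂ] K}
    (hV : ∀ i s γ x, V i s (J γ x) = J (γ * Pi.mulSingle i (FreeMonoid.of s)) x)
    {𝒱 : Set (K →L[ℂ] K)} (hcomm : ∀ f ∈ 𝒱, ∀ i s, Commute f (V i s))
    (hshift : ∀ (α : MultiWord n) (B : E →L[ℂ] E), ∃ g ∈ 𝒱, ∀ γ x, g (J γ x) = J (α * γ) (B x)) :
    {A : K →L[ℂ] K | ∀ i s t, star (V i s) * A * V i t = if s = t then A else 0}
        = sotClosure (starMulSpan 𝒱) ∧
      {A : K →L[ℂ] K | ∀ i s t, star (V i s) * A * V i t = if s = t then A else 0}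
        = wotClosure (starMulSpan 𝒱) := by
  classical
  have hVV : ∀ i (s t : Fin (n i)), star (V i s) * V i t = if s = t then 1 else 0 := by
    intro i s t
    refine hJ.clm_ext fun δ x => ?_
    refine hJ.linearIsometryEquiv.injective (lp.ext (funext fun γ => ext_inner_left ℂ fun y => ?_))
    rw [hJ.inner_coeff, hJ.inner_coeff, mul_apply_eq_comp,
      ContinuousLinearMap.star_eq_adjoint, ContinuousLinearMap.adjoint_inner_right, hV, hV,
      hJ.inner_eq]
    by_cases hst : s = t
    · subst hst
      simp [hJ.inner_eq]
    · rw [if_neg hst, if_neg]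
      · simp
      · intro e
        have e' := congrFun e i
        simp only [Pi.mul_apply, Pi.mulSingle_eq_same] at e'
        exact hst (FreeMonoid.mul_of_inj e')
  have h1 : {A : K →L[ℂ] K | ∀ i s t, star (V i s) * A * V i t = if s = t then A else 0}
      ⊆ sotClosure (starMulSpan 𝒱) := by
    intro A hA
    refine mem_sotClosure_starMulSpan hJ hshift fun x y i s t γ δ => ?_
    have := congrArg (fun T : K →L[ℂ] K => inner ℂ (J γ y) (T (J δ x))) (hA i s t)
    simp only [mul_apply_eq_comp, ContinuousLinearMap.star_eq_adjoint,
      ContinuousLinearMap.adjoint_inner_right, hV] at this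
    refine this.trans ?_
    split_ifs <;> simp
  have h2 : wotClosure (starMulSpan 𝒱)
      ⊆ {A : K →L[ℂ] K | ∀ i s t, star (V i s) * A * V i t = if s = t then A else 0} :=
    fun A hA i => star_mul_mul_of_mem_wotClosure (hVV i) (fun f hf => hcomm f hf i) hA
  have h3 := sotClosure_subset_wotClosure (starMulSpan 𝒱)
  -- The chain Toeplitz ⊆ strong closure ⊆ weak closure ⊆ Toeplitz closes up.
  exact ⟨h1.antisymm (h3.trans h2), (h1.trans h3).antisymm h2⟩

end Abstract

/-! ### Operators on Hilbert tensor products -/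

theorem ContinuousLinearMap.isClosed_centralizer {K : Type*} [NormedAddCommGroup K]
    [InnerProductSpace ℂ K] (S : Set (K →L[ℂ] K)) : IsClosed S.centralizer :=
  Set.isClosed_centralizer S

section Tensor

variable {E F : Type*} [NormedAddCommGroup E] [InnerProductSpace ℂ E]
  [NormedAddCommGroup F] [InnerProductSpace ℂ F]

theorem HilbertTensor.induction_tmul {p : HilbertTensor E F → Prop} (hc : IsClosed {u | p u})
    (hadd : ∀ u v, p u → p v → p (u + v))
    (ht : ∀ x y, p ((x ⊗ₜ[ℂ] y : E ⊗[ℂ] F) : HilbertTensor E F)) (u : HilbertTensor E F) : p u := by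
  refine UniformSpace.Completion.induction_on u hc fun w => ?_
  induction w using TensorProduct.induction_on with
  | zero => simpa using ht 0 0
  | tmul x y => exact ht x y
  | add a b ha hb => rw [UniformSpace.Completion.coe_add]; exact hadd _ _ ha hb

theorem HilbertTensor.clm_ext {S T : HilbertTensor E F →L[ℂ] HilbertTensor E F}
    (h : ∀ x y, S ((x ⊗ₜ[ℂ] y : E ⊗[ℂ] F) : HilbertTensor E F)
      = T ((x ⊗ₜ[ℂ] y : E ⊗[ℂ] F) : HilbertTensor E F)) : S = T := by
  ext u
  refine HilbertTensor.induction_tmul (p := fun u => S u = T u)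
    (isClosed_eq S.continuous T.continuous) (fun u v hu hv => by simp [hu, hv]) h u

theorem opTensor_mul (a b : E →L[ℂ] E) (S T : F →L[ℂ] F) :
    opTensor a S * opTensor b T = opTensor (a * b) (S * T) :=
  HilbertTensor.clm_ext fun x y => by
    simp [opTensor_tmul]

/-- Turns the left factor in `IsMultiToeplitz` into the adjoint of the right one, as
`toeplitz_eq_closures` requires. -/
theorem opTensor_one_star [CompleteSpace F] (T : F →L[ℂ] F) :
    opTensor (1 : E →L[ℂ] E) (star T) = star (opTensor 1 T) := by
  rw [ContinuousLinearMap.star_eq_adjoint (opTensor 1 T), ContinuousLinearMap.eq_adjoint_iff]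
  intro u v
  refine HilbertTensor.induction_tmul (p := fun u => inner ℂ (opTensor (1 : E →L[ℂ] E) (star T) u) v
    = inner ℂ u (opTensor 1 T v))
    (isClosed_eq (by fun_prop) (by fun_prop))
    (fun u w hu hw => by simp [inner_add_left, hu, hw]) (fun x y => ?_) u
  refine HilbertTensor.induction_tmul (p := fun v =>
    inner ℂ (opTensor (1 : E →L[ℂ] E) (star T) ((x ⊗ₜ[ℂ] y : E ⊗[ℂ] F) : HilbertTensor E F)) v
      = inner ℂ ((x ⊗ₜ[ℂ] y : E ⊗[ℂ] F) : HilbertTensor E F) (opTensor 1 T v))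
    (isClosed_eq (by fun_prop) (by fun_prop))
    (fun u w hu hw => by simp [inner_add_right, hu, hw]) (fun x' y' => ?_) v
  simp only [opTensor_tmul, UniformSpace.Completion.inner_coe, TensorProduct.inner_tmul,
    ContinuousLinearMap.star_eq_adjoint, ContinuousLinearMap.adjoint_inner_left,
    one_apply_eq_self]

/-- The isometry `x ↦ x ⊗ e` for a unit vector `e`. -/
def tensorRight (E : Type*) [NormedAddCommGroup E] [InnerProductSpace ℂ E] {e : F} (he : ‖e‖ = 1) :
    E →ₗᵢ[ℂ] HilbertTensor E F where
  toLinearMap := (UniformSpace.Completion.toComplₗᵢ (𝕜 := ℂ) (E := E ⊗[ℂ] F)).toLinearMap ∘ₗ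
    (TensorProduct.mk ℂ E F).flip e
  norm_map' x := by simp [he]

theorem tensorRight_apply {e : F} (he : ‖e‖ = 1) (x : E) :
    tensorRight E he x = ((x ⊗ₜ[ℂ] e : E ⊗[ℂ] F) : HilbertTensor E F) := rfl

/-- Expanding `y` in the basis makes `x ⊗ y` a limit of finite sums of vectors `x ⊗ b i`, so the
orthogonal copies of `E` have dense span. -/
theorem HilbertBasis.isHilbertSum_tensorRight [CompleteSpace E] {ι : Type*}
    (b : HilbertBasis ι ℂ F) :
    IsHilbertSum ℂ (fun _ : ι => E) fun i => tensorRight E (b.orthonormal.1 i) := by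
  classical
  refine IsHilbertSum.mk (fun i j hij x y => ?_) fun u _ => ?_
  · simp [tensorRight_apply, UniformSpace.Completion.inner_coe, b.orthonormal.2 hij]
  · refine HilbertTensor.induction_tmul (p := fun u => u ∈ (⨆ i, LinearMap.range
      (tensorRight E (b.orthonormal.1 i)).toLinearMap).topologicalClosure)
      (Submodule.isClosed_topologicalClosure _)
      (fun _ _ => Submodule.add_mem _) (fun x y => ?_) u
    have hs := b.hasSum_repr y
    have hc : Continuous fun y : F => ((x ⊗ₜ[ℂ] y : E ⊗[ℂ] F) : HilbertTensor E F) :=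
      (UniformSpace.Completion.continuous_coe _).comp (TensorProduct.mkL ℂ E F x).continuous
    refine (Submodule.isClosed_topologicalClosure _).mem_of_tendsto ((hc.tendsto y).comp hs)
      (Filter.Eventually.of_forall fun s => Submodule.le_topologicalClosure _ ?_)
    simp only [Function.comp_apply, TensorProduct.tmul_sum, TensorProduct.tmul_smul]
    have : ((∑ i ∈ s, b.repr y i • x ⊗ₜ[ℂ] b i : E ⊗[ℂ] F) : HilbertTensor E F)
        = ∑ i ∈ s, b.repr y i • tensorRight E (b.orthonormal.1 i) x := by
      simp only [tensorRight_apply, ← UniformSpace.Completion.coe_smul]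
      exact map_sum (UniformSpace.Completion.toComplₗᵢ (𝕜 := ℂ) (E := E ⊗[ℂ] F)) _ _
    rw [this]
    exact Submodule.sum_mem _ fun i _ => Submodule.smul_mem _ _
      (Submodule.mem_iSup_of_mem i ⟨x, rfl⟩)

/-- The centralizer of `1 ⊗ R` is a norm-closed subspace containing every `a ⊗ T` with `T ∈ 𝒜`. -/
theorem Commute.of_mem_minTensor {𝒜 : Subalgebra ℂ (F →L[ℂ] F)} {R : F →L[ℂ] F}
    (h : ∀ T ∈ 𝒜, Commute T R) {f : HilbertTensor E F →L[ℂ] HilbertTensor E F}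
    (hf : f ∈ minTensor E 𝒜) : Commute f (opTensor 1 R) := by
  let C := Subalgebra.centralizer ℂ {opTensor (1 : E →L[ℂ] E) R}
  have hle : minTensor E 𝒜 ≤ Subalgebra.toSubmodule C := by
    refine Submodule.topologicalClosure_minimal _ (Submodule.span_le.2 ?_)
      (ContinuousLinearMap.isClosed_centralizer _)
    rintro _ ⟨a, T, hT, rfl⟩
    refine Subalgebra.mem_centralizer_iff ℂ |>.2 ?_
    rintro _ rfl
    rw [opTensor_mul, opTensor_mul, one_mul, mul_one, (h T hT).eq]
  exact ((Subalgebra.mem_centralizer_iff ℂ).1 (hle hf) _ rfl).symm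

end Tensor

/-! ### The polyball algebra -/

section Polyball

variable {k : ℕ} {n : Fin k → ℕ}

/-- The standard orthonormal basis of `F²(H_{n₁}) ⊗ ⋯ ⊗ F²(H_{n_k})`. -/
def polyFockBasis (n : Fin k → ℕ) : HilbertBasis (MultiWord n) ℂ (PolyFock n) :=
  HilbertBasis.ofRepr (LinearIsometryEquiv.refl ℂ _)

theorem ampliation_polyFockBasis (i : Fin k) {φ : FreeMonoid (Fin (n i)) → FreeMonoid (Fin (n i))}
    (hφ : Function.Injective φ) (γ : MultiWord n) :
    ampliation i hφ (polyFockBasis n γ)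
      = polyFockBasis n (Function.update γ i (φ (γ i))) := by
  classical
  rw [← HilbertBasis.repr_symm_single, ← HilbertBasis.repr_symm_single]
  exact basisIsometry_single _ (coordMap_injective i hφ) γ

theorem polyS_polyFockBasis (i : Fin k) (j : Fin (n i)) (γ : MultiWord n) :
    polyS n i j (polyFockBasis n γ) = polyFockBasis n (Pi.mulSingle i (FreeMonoid.of j) * γ) := by
  rw [Pi.mulSingle_mul_eq_update]; exact ampliation_polyFockBasis i _ γ

theorem polyR_polyFockBasis (i : Fin k) (j : Fin (n i)) (γ : MultiWord n) :
    polyR n i j (polyFockBasis n γ) = polyFockBasis n (γ * Pi.mulSingle i (FreeMonoid.of j)) := by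
  rw [Pi.mul_mulSingle_eq_update]; exact ampliation_polyFockBasis i _ γ

/-- Puts the scalar case in the form of the abstract theorem, with coefficient space `ℂ`. -/
theorem isHilbertSum_polyFock (n : Fin k → ℕ) : IsHilbertSum ℂ (fun _ : MultiWord n => ℂ)
    fun γ => LinearIsometry.toSpanSingleton ℂ (PolyFock n) ((polyFockBasis n).orthonormal.1 γ) :=
  (polyFockBasis n).orthonormal.isHilbertSum (polyFockBasis n).dense_span.ge

theorem commute_polyR {T : PolyFock n →L[ℂ] PolyFock n} (hT : T ∈ polyballAlgebra n) (i : Fin k)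
    (s : Fin (n i)) : Commute T (polyR n i s) := by
  let C := Subalgebra.centralizer ℂ {polyR n i s}
  have hle : polyballAlgebra n ≤ C := by
    refine Subalgebra.topologicalClosure_minimal (Algebra.adjoin_le ?_) (Set.isClosed_centralizer _)
    rintro _ ⟨l, j, rfl⟩
    refine Subalgebra.mem_centralizer_iff ℂ |>.2 ?_
    rintro _ rfl
    refine (isHilbertSum_polyFock n).clm_ext fun γ c => ?_
    simp [polyS_polyFockBasis, polyR_polyFockBasis, mul_assoc]
  exact ((Subalgebra.mem_centralizer_iff ℂ).1 (hle hT) _ rfl).symm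

/-- The operator is a monomial in the `polyS n i j`: realizable `α` form a submonoid containing the
letters. -/
theorem exists_leftShift (α : MultiWord n) :
    ∃ T ∈ polyballAlgebra n, ∀ γ, T (polyFockBasis n γ) = polyFockBasis n (α * γ) := by
  let H : Submonoid (MultiWord n) :=
    { carrier := {α | ∃ T ∈ polyballAlgebra n,
        ∀ γ, T (polyFockBasis n γ) = polyFockBasis n (α * γ)}
      one_mem' := ⟨1, one_mem _, by simp⟩
      mul_mem' := by
        rintro α β ⟨S, hS, hSα⟩ ⟨T, hT, hTβ⟩
        exact ⟨S * T, mul_mem hS hT, fun γ => by simp [hSα, hTβ, mul_assoc]⟩ }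
  exact MultiWord.induction_letters H (fun i j => ⟨polyS n i j,
    Subalgebra.le_topologicalClosure _ (Algebra.subset_adjoin ⟨i, j, rfl⟩),
    polyS_polyFockBasis i j⟩) α

end Polyball
end

/-! ### The theorem -/

theorem mainTheorem1 {k : ℕ} (hk : 1 ≤ k) (n : Fin k → ℕ) (hn : ∀ i, 1 ≤ n i)
    (E : Type*) [NormedAddCommGroup E] [InnerProductSpace ℂ E] [CompleteSpace E] :
    ({A : HilbertTensor E (PolyFock n) →L[ℂ] HilbertTensor E (PolyFock n) | IsMultiToeplitz n A}
        = sotClosure (starMulSpan (minTensor E (polyballAlgebra n))) ∧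
      {A : HilbertTensor E (PolyFock n) →L[ℂ] HilbertTensor E (PolyFock n) | IsMultiToeplitz n A}
        = wotClosure (starMulSpan (minTensor E (polyballAlgebra n)))) ∧
    ({T : PolyFock n →L[ℂ] PolyFock n | IsScalarMultiToeplitz n T}
        = sotClosure (starMulSpan (polyballAlgebra n)) ∧
      {T : PolyFock n →L[ℂ] PolyFock n | IsScalarMultiToeplitz n T}
        = wotClosure (starMulSpan (polyballAlgebra n))) := by
  constructor
  · simp only [IsMultiToeplitz, opTensor_one_star]
    refine toeplitz_eq_closures ((polyFockBasis n).isHilbertSum_tensorRight (E := E))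
      (V := fun i s => opTensor 1 (polyR n i s)) (fun i s γ x => ?_)
      (fun f hf i s => Commute.of_mem_minTensor (fun T hT => commute_polyR hT i s) hf)
      fun α B => ?_
    · simp [tensorRight_apply, opTensor_tmul, polyR_polyFockBasis]
    · obtain ⟨T, hT, h⟩ := exists_leftShift α
      refine ⟨opTensor B T, Submodule.le_topologicalClosure _
        (Submodule.subset_span ⟨B, T, hT, rfl⟩), fun γ x => ?_⟩
      simp [tensorRight_apply, opTensor_tmul, h]
  · refine toeplitz_eq_closures (isHilbertSum_polyFock n) (V := polyR n) (fun i s γ x => ?_)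
      (fun f hf i s => commute_polyR hf i s) fun α B => ?_
    · simp [polyR_polyFockBasis]
    · obtain ⟨T, hT, h⟩ := exists_leftShift α
      -- A linear map `B` on `ℂ` is multiplication by `B 1`, so a weighted shift is a scalar
      -- multiple of a shift.
      refine ⟨B 1 • T, Subalgebra.smul_mem _ hT _, fun γ x => ?_⟩
      have hB : B x = x * B 1 := by
        conv_lhs => rw [← mul_one x, ← smul_eq_mul, map_smul, smul_eq_mul]
      simp [h, hB, smul_smul]
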